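/- Let $G=(V,E)$ be a finite connected graph, with possible parallel edges and loops. Let $\mathbb E$ be the set of oriented edges (each edge gives two, $e$ and $\bar e$). For $A=\mathbb Z$ or $\mathbb R$ let $C^0(G,A)$ be the module of functions $V\to A$, let $C^1(G,A)$ be the module of functions $g:\mathbb E\to A$ with $g(\bar e)=-g(e)$, and let $d:C^0(G,A)\to C^1(G,A)$, $d(f)(e)=f(u)-f(v)$, where $u$ is the head and $v$ the tail of $e$. On $C^1(G,\mathbb R)$ put $\langle x,y\rangle=\sum x_ey_e$, the sum having one term for each unoriented edge, and $q(x)=\langle x,x\rangle$. Let $K=d(C^0(G,\mathbb R))$, let $L=d(C^0(G,\mathbb Z))\subset K$ be the lattice of integer cuts, and let $V_O=\{x\in K: q(x)\le q(x-\mu)\text{ for all }\mu\in L\}$ be the Voronoi cell of the origin. Let $\mathcal{FP}^c$ be the set of nonempty faces of $V_O$ (including $V_O$ itself), ordered by inclusion. For an ordered partition $V_1,\dots,V_s$ of $V$ into nonempty parts, the cut subgraph $H$ of $G$ that it defines consists of all edges joining different parts, and the associated coherent acyclic orientation of $H$ orients every edge between $V_i$ and $V_j$, $i<j$, from $V_i$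 to $V_j$. Let $\mathcal{CAC}$ be the set of all coherent acyclic orientations of cut subgraphs of $G$, regarded as subsets of $\mathbb E$, ordered by $D_1\preceq D_2$ if and only if $D_2\subseteq D_1$. By an acyclic orientation of $G$ we mean an orientation, without oriented cycles, of all edges of $G$ that are not loops. For $C\subseteq V$ let $\chi_C$ be its characteristic function, and let the rank of the cut defined by $C$ be the number of connected components of $G[C]$ plus that of $G[V\setminus C]$, minus $1$. A bond element is an element $\lambda=d(\chi_C)$ of $L$ where the cut defined by $C$ has rank $1$. Put $\mathrm{supp}(\lambda)=\{e\in\mathbb E:\lambda_e>0\}$ and $K_\lambda=\{x\in K:2\langle x,\lambda\rangle=q(\lambda)\}$, and for a face $F$ let $\phi^c(F)$ be the union of the sets $\mathrm{supp}(\lambda)$ over all bond elements $\lambda$ with $F\subseteq K_\lambda$. **Theorem.** The map $F\mapsto\phi^c(F)$ is an isomorphism of posets from $\mathcal{FP}^c$ onto $\mathcal{CAC}$. Moreover, there is a bijection $D\mapsto\nu^D$ from the acyclic orientations of $G$ onto the vertices of $V_O$ such that $\{\nu^D\}$ is a face of $V_O$ with $\phi^c(\{\nu^D\})=D$ for every $D$,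 and such that every face $F\in\mathcal{FP}^c$ is the convex hull of the vertices $\nu^D$, for $D$ running over all acyclic orientations of $G$ that contain $\phi^c(F)$. -/

import Mathlib

/-- A graph in the sense of Serre, possibly with parallel edges and loops: `V` is the set of
vertices, `E` the set of *oriented* edges, `bar` sends an oriented edge to its inverse. An
(unoriented) edge is a pair `{e, bar e}`. -/
structure CutGraph (V E : Type*) where
  tail : E → V
  head : E → V
  bar : E → E
  bar_bar : ∀ e, bar (bar e) = e
  bar_ne : ∀ e, bar e ≠ e
  tail_bar : ∀ e, tail (bar e) = head e

namespace CutGraph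

variable {V E : Type*}

theorem head_bar (G : CutGraph V E) (e : E) : G.head (G.bar e) = G.tail e := by
  rw [← G.tail_bar, G.bar_bar]

/-- `u` and `v` are joined by an oriented edge belonging to `D`. -/
def Step (G : CutGraph V E) (D : Set E) (u v : V) : Prop :=
  ∃ e ∈ D, G.tail e = u ∧ G.head e = v

/-- `G` is connected: it has a vertex, and any two vertices are joined by a path. -/
def Connected (G : CutGraph V E) : Prop :=
  Nonempty V ∧ ∀ u v : V, Relation.ReflTransGen (G.Step Set.univ) u v

/-! ### Cochains -/

/-- `C¹(G, A)`: functions `g` on oriented edges with `g (bar e) = - g e`. -/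
def cochains (G : CutGraph V E) (A : Type*) [CommRing A] : Submodule A (E → A) where
  carrier := {g | ∀ e, g (G.bar e) = - g e}
  add_mem' := by
    intro a b ha hb e
    simp only [Pi.add_apply, ha e, hb e]
    ring
  zero_mem' := by
    intro e
    simp
  smul_mem' := by
    intro c a ha e
    simp only [Pi.smul_apply, ha e, smul_neg]

/-- The differential `d : C⁰(G, A) → C¹(G, A)`, `(d f)(e) = f (head e) - f (tail e)`. -/
def d (G : CutGraph V E) (A : Type*) [CommRing A] : (V → A) →ₗ[A] G.cochains A where
  toFun f := ⟨fun e => f (G.head e) - f (G.tail e), by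
    intro e
    simp only [G.head_bar, G.tail_bar]
    ring⟩
  map_add' := by
    intro f g
    ext e
    simp only [Pi.add_apply, Submodule.coe_add]
    ring
  map_smul' := by
    intro c f
    ext e
    simp only [Pi.smul_apply, smul_eq_mul, RingHom.id_apply, Submodule.coe_smul]
    ring

/-- The space `K = im (d : C⁰(G, ℝ) → C¹(G, ℝ))`. -/
def cutSpace (G : CutGraph V E) : Submodule ℝ (G.cochains ℝ) :=
  LinearMap.range (G.d ℝ)

/-- The lattice of integer cuts: the image under `d` of the integer-valued functions on `V`, inside
`C¹(G, ℝ)`. -/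
def cutLattice (G : CutGraph V E) : AddSubgroup (G.cochains ℝ) :=
  ((G.d ℝ).toAddMonoidHom.comp ((Int.castAddHom ℝ).compLeft V)).range

/-- The inner product on `C¹(G, ℝ)`, the sum of `x e * y e` over unoriented edges. The sum below
counts each unoriented edge twice, once for each orientation. -/
noncomputable def ip (G : CutGraph V E) [Fintype E] (x y : G.cochains ℝ) : ℝ :=
  (1 / 2) * ∑ e, x.1 e * y.1 e

/-- The quadratic form `q(x) = ⟨x, x⟩`. -/
noncomputable def q (G : CutGraph V E) [Fintype E] (x : G.cochains ℝ) : ℝ :=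
  G.ip x x

/-- The Voronoi cell, in `K`, of the lattice point `lam`. -/
def voronoiCell (G : CutGraph V E) [Fintype E] (lam : G.cochains ℝ) : Set (G.cochains ℝ) :=
  {x | x ∈ G.cutSpace ∧ ∀ mu ∈ G.cutLattice, G.q (x - lam) ≤ G.q (x - mu)}

/-- The face poset of the Voronoi cell of the origin: its nonempty faces (the cell itself included),
ordered by inclusion. A face is the locus where a linear form attains its maximum on the cell. -/
abbrev Face (G : CutGraph V E) [Fintype E] : Type _ :=
  {F : Set (G.cochains ℝ) // F.Nonempty ∧ IsExposed ℝ (G.voronoiCell 0) F}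

/-! ### Orientations

All subgraphs considered have vertex set `V`, so a subgraph is given by its set of edges, that is
by a set of oriented edges closed under `bar`. -/

/-- `D` is an orientation of the subgraph `H`: it consists of edges of `H` and contains exactly one
of `e`, `bar e` for every edge `e` of `H`. -/
def IsOrientation (G : CutGraph V E) (H D : Set E) : Prop :=
  D ⊆ H ∧ ∀ e ∈ H, Xor (e ∈ D) (G.bar e ∈ D)

/-- The cut subgraph defined by the partition of `V` into the fibres of `p`: the edges
whose end-points lie in different parts. -/
def cutSubgraph (G : CutGraph V E) {s : ℕ} (p : V → Fin s) : Set E :=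
  {e | p (G.tail e) ≠ p (G.head e)}

/-- `D` is a coherent acyclic orientation of the cut subgraph `H`: for some ordered partition of `V`
into `s` nonempty parts, the fibres of `p`, `H` is the cut subgraph that it defines and `D` orients
every edge of `H` from the part with the smaller index to the part with the larger index. -/
def IsCoherentAcyclic (G : CutGraph V E) (H D : Set E) : Prop :=
  G.IsOrientation H D ∧ ∃ (s : ℕ) (p : V → Fin s), Function.Surjective p ∧
    H = G.cutSubgraph p ∧ ∀ e ∈ H, (e ∈ D ↔ p (G.tail e) < p (G.head e))

/-- The set of coherent acyclic orientations of cut subgraphs of `G`. (The subgraph is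
determined by its orientation.) -/
structure CAC (G : CutGraph V E) where
  edges : Set E
  coherent : ∃ H, G.IsCoherentAcyclic H edges

/-- `D₁ ≼ D₂` if and only if `D₂ ⊆ D₁`. -/
instance (G : CutGraph V E) : PartialOrder G.CAC where
  le D₁ D₂ := D₂.edges ⊆ D₁.edges
  le_refl _ := subset_rfl
  le_trans _ _ _ h₁ h₂ := h₂.trans h₁
  le_antisymm D₁ D₂ h₁ h₂ := by
    cases D₁
    cases D₂
    congr
    exact Set.Subset.antisymm h₂ h₁

/-- `D` contains no oriented cycle. -/
def IsAcyclic (G : CutGraph V E) (D : Set E) : Prop :=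
  ∀ v, ¬ Relation.TransGen (G.Step D) v v

/-- The acyclic orientations of the whole graph `G`. A loop is a cycle in both of its orientations,
so loops are left unoriented; for a loopless graph all edges are oriented. -/
abbrev AcyclicOrientation (G : CutGraph V E) : Type _ :=
  {D : Set E // G.IsOrientation {e | G.tail e ≠ G.head e} D ∧ G.IsAcyclic D}

/-! ### Bonds, and the oriented subgraph attached to a face -/

/-- The number of connected components of the induced subgraph `G[C]`. -/
noncomputable def numComponents (G : CutGraph V E) (C : Set V) : ℕ :=
  Nat.card (Quot fun u v : C => G.Step Set.univ u.1 v.1)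

/-- The rank of the cut defined by `C`. -/
noncomputable def cutRank (G : CutGraph V E) (C : Set V) : ℕ :=
  G.numComponents C + G.numComponents Cᶜ - 1

/-- The cut-element `d χ_C`, with `χ_C` the characteristic function of `C`. -/
noncomputable def cutElement (G : CutGraph V E) (C : Set V) : G.cochains ℝ :=
  G.d ℝ (C.indicator 1)

/-- The bond elements of the lattice: the `d χ_C` where the cut defined by `C` has rank one. -/
def bonds (G : CutGraph V E) : Set (G.cochains ℝ) :=
  {lam | ∃ C : Set V, G.cutRank C = 1 ∧ lam = G.cutElement C}

/-- The support of `x`: the oriented edges where `x` is positive. -/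
def supp (G : CutGraph V E) (x : G.cochains ℝ) : Set E :=
  {e | 0 < x.1 e}

/-- The affine hyperplane `K_lam = {x ∈ K | 2⟨x, lam⟩ = q(lam)}`. -/
def bisector (G : CutGraph V E) [Fintype E] (lam : G.cochains ℝ) : Set (G.cochains ℝ) :=
  {x | x ∈ G.cutSpace ∧ 2 * G.ip x lam = G.q lam}

/-- The union of the supports of all bond elements `lam` such that `F` lies in `K_lam`. -/
def faceEdges (G : CutGraph V E) [Fintype E] (F : Set (G.cochains ℝ)) : Set E :=
  {e | ∃ lam ∈ G.bonds, F ⊆ G.bisector lam ∧ e ∈ G.supp lam}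

end CutGraph

/-! The support function of the cell on cuts is explicit: the maximum of `⟨x, d f⟩` is `cutNorm f`,
half the sum of `|d f|` over unoriented edges. The upper bound (`ip_le_cutNorm`) holds because `f`
can be peeled into positive multiples of indicators of superlevel sets, without cancellation
(`exists_split_ascents`), and each indicator contributes one Voronoi inequality. The bound is
attained at the projection to `K` of the half-cochain of an acyclic orientation `D` exactly when
`ascents f ⊆ D` (`AcyclicOrientation.ip_eq_cutNorm_iff`).

Every linear form on `K` is pairing with a cut, so the nonempty faces are the sets `cutFace f`. By
splitting, `cutFace f` shrinks as `ascents f` grows; by separation and a small perturbation of `f`,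
it is the convex hull of the points of the orientations containing `ascents f`
(`cutFace_eq_convexHull`). Coherent acyclic orientations of cut subgraphs are exactly the sets
`ascents f`, and `faceEdges_cutFace` recovers `ascents f` from the face. Connectedness of `G` enters
there, to refine a superlevel cut to a bond. -/

namespace CutGraph

variable {V E : Type*}

/-! ### Bonds separating two vertices -/

/-- Adjacency inside the induced subgraph on `C`. -/
def AdjIn (G : CutGraph V E) (C : Set V) (u v : V) : Prop :=
  u ∈ C ∧ v ∈ C ∧ G.Step Set.univ u v

/-- The connected component of `r` in the induced subgraph on `C`. -/
def componentIn (G : CutGraph V E) (C : Set V) (r : V) : Set V :=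
  {v | Relation.ReflTransGen (G.AdjIn C) r v}

theorem componentIn_subset (G : CutGraph V E) {C : Set V} {r : V} (hr : r ∈ C) :
    G.componentIn C r ⊆ C := by
  intro v hv
  rcases Relation.ReflTransGen.cases_tail hv with rfl | ⟨w, -, h⟩
  · exact hr
  · exact h.2.1

theorem reflTransGen_componentIn (G : CutGraph V E) {C : Set V} {r v : V}
    (hv : v ∈ G.componentIn C r) :
    Relation.ReflTransGen (G.AdjIn (G.componentIn C r)) r v := by
  have hv' : Relation.ReflTransGen (G.AdjIn C) r v := hv
  clear hv
  induction hv' with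
  | refl => exact .refl
  | tail hab hbc ih => exact ih.tail ⟨hab, hab.tail hbc, hbc.2.2⟩

theorem head_mem_componentIn (G : CutGraph V E) {C : Set V} {r : V} (hr : r ∈ C) {e : E}
    (ht : G.tail e ∈ G.componentIn C r) (hh : G.head e ∈ C) :
    G.head e ∈ G.componentIn C r :=
  Relation.ReflTransGen.tail ht ⟨G.componentIn_subset hr ht, hh, e, trivial, rfl, rfl⟩

theorem tail_mem_componentIn (G : CutGraph V E) {C : Set V} {r : V} (hr : r ∈ C) {e : E}
    (hh : G.head e ∈ G.componentIn C r) (ht : G.tail e ∈ C) :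
    G.tail e ∈ G.componentIn C r := by
  have := G.head_mem_componentIn hr (e := G.bar e)
  rw [G.tail_bar, G.head_bar] at this
  exact this hh ht

theorem numComponents_eq_one (G : CutGraph V E) {C : Set V} {r : V} (hr : r ∈ C)
    (h : ∀ v ∈ C, Relation.ReflTransGen (G.AdjIn C) r v) : G.numComponents C = 1 := by
  have key : ∀ v, Relation.ReflTransGen (G.AdjIn C) r v → ∀ hv : v ∈ C,
      Quot.mk (fun u v : C => G.Step Set.univ u.1 v.1) ⟨r, hr⟩ = Quot.mk _ ⟨v, hv⟩ := by
    intro v hrv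
    induction hrv with
    | refl => intro _; rfl
    | tail _ hbc ih => intro hv; exact (ih hbc.1).trans (Quot.sound hbc.2.2)
  refine Nat.card_eq_one_iff_exists.2 ⟨Quot.mk _ ⟨r, hr⟩, ?_⟩
  rintro ⟨v⟩
  exact (key v (h v v.2) v.2).symm

/-- In a connected graph, any cut separating `h` from `t` contains a bond separating them. -/
theorem exists_bond_of_cut (G : CutGraph V E) (hG : G.Connected) {C : Set V} {h t : V}
    (hh : h ∈ C) (ht : t ∉ C) :
    ∃ B : Set V, G.cutRank B = 1 ∧ h ∈ B ∧ t ∉ B ∧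
      ∀ e, G.head e ∈ B → G.tail e ∉ B → G.head e ∈ C ∧ G.tail e ∉ C := by
  -- The bond is `Tᶜ`, with `T` a component of the complement of a component `A` of `C`. A path from
  -- `h` cannot step from `T` to a vertex outside both `T` and `A`, so `Tᶜ` is connected; edges
  -- between `T` and `Tᶜ` end in `A`, hence lie in the original cut.
  set A := G.componentIn C h with hA
  have hhA : h ∈ A := .refl
  have htA : t ∈ Aᶜ := fun hc => ht (G.componentIn_subset hh hc)
  set T := G.componentIn Aᶜ t with hT
  have hTA : T ⊆ Aᶜ := G.componentIn_subset htA
  have hAT : A ⊆ Tᶜ := fun v hv hvT => hTA hvT hv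
  have hconn : ∀ v ∈ Tᶜ, Relation.ReflTransGen (G.AdjIn Tᶜ) h v := by
    intro v
    induction hG.2 h v with
    | refl => intro _; exact .refl
    | @tail b c _ hbc ih =>
      intro hc
      by_cases hcA : c ∈ A
      · exact Relation.ReflTransGen.mono (fun u v huv =>
          ⟨hAT huv.1, hAT huv.2.1, huv.2.2⟩) _ _ (G.reflTransGen_componentIn hcA)
      · have hb : b ∈ Tᶜ := by
          intro hbT
          obtain ⟨e, -, rfl, rfl⟩ := hbc
          exact hc (G.head_mem_componentIn htA hbT hcA)
        exact (ih hb).tail ⟨hb, hc, hbc⟩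
  refine ⟨Tᶜ, ?_, hAT hhA, fun hc => hc .refl, ?_⟩
  · rw [cutRank, compl_compl, G.numComponents_eq_one (hAT hhA) hconn,
      G.numComponents_eq_one (r := t) .refl fun v hv => G.reflTransGen_componentIn hv]
  · intro e he hte
    have hte : G.tail e ∈ T := not_not.1 hte
    have heA : G.head e ∈ A := by
      by_contra hc
      exact he (G.head_mem_componentIn htA hte hc)
    exact ⟨G.componentIn_subset hh heA, fun hc => hTA hte (G.tail_mem_componentIn hh heA hc)⟩

/-! ### Sets of ascending edges -/

/-- The oriented edges along which `f` increases. -/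
def ascents (G : CutGraph V E) {α : Type*} [LT α] (f : V → α) : Set E :=
  {e | f (G.tail e) < f (G.head e)}

theorem mem_ascents {G : CutGraph V E} {α : Type*} [LT α] {f : V → α} {e : E} :
    e ∈ G.ascents f ↔ f (G.tail e) < f (G.head e) := Iff.rfl

theorem isAcyclic_ascents (G : CutGraph V E) {α : Type*} [Preorder α] (f : V → α) :
    G.IsAcyclic (G.ascents f) := by
  have key : ∀ u v, Relation.TransGen (G.Step (G.ascents f)) u v → f u < f v := by
    intro u v h
    induction h with
    | single h => obtain ⟨e, he, rfl, rfl⟩ := h; exact he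
    | tail _ h ih => obtain ⟨e, he, rfl, rfl⟩ := h; exact ih.trans he
  exact fun v hv => lt_irrefl _ (key v v hv)

theorem isOrientation_ascents (G : CutGraph V E) {α : Type*} [LinearOrder α] (f : V → α) :
    G.IsOrientation {e | f (G.tail e) ≠ f (G.head e)} (G.ascents f) := by
  refine ⟨fun e he => ne_of_lt he, fun e he => ?_⟩
  simp only [mem_ascents, G.tail_bar, G.head_bar]
  rcases lt_or_gt_of_ne he with h | h
  · exact Or.inl ⟨h, h.not_gt⟩
  · exact Or.inr ⟨h, h.not_gt⟩

/-- An orientation of all edges that are not loops contains exactly one orientation of each. -/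
theorem AcyclicOrientation.bar_mem_iff {G : CutGraph V E} (D : G.AcyclicOrientation) {e : E}
    (he : G.tail e ≠ G.head e) : G.bar e ∈ D.1 ↔ e ∉ D.1 := by
  rcases D.2.1.2 e he with h | h <;> simp [h.1, h.2]

theorem AcyclicOrientation.not_loop {G : CutGraph V E} (D : G.AcyclicOrientation) {e : E}
    (he : e ∈ D.1) : G.tail e ≠ G.head e := D.2.1.1 he

theorem AcyclicOrientation.eq_of_subset {G : CutGraph V E} {D D' : G.AcyclicOrientation}
    (h : D.1 ⊆ D'.1) : D = D' := by
  refine Subtype.ext (h.antisymm fun e he => ?_)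
  by_contra hc
  exact (D'.bar_mem_iff (D'.not_loop he)).1 (h ((D.bar_mem_iff (D'.not_loop he)).2 hc)) he

/-- Ascending edges of a function extend to an acyclic orientation. -/
theorem exists_acyclicOrientation_ascents_subset (G : CutGraph V E) [Finite V] (f : V → ℝ) :
    ∃ D : G.AcyclicOrientation, G.ascents f ⊆ D.1 := by
  obtain ⟨n, ⟨i⟩⟩ := Finite.exists_equiv_fin V
  -- Ties of `f` are broken by an enumeration of `V`; injectivity makes every non-loop either ascend
  -- or descend.
  let g : V → ℝ ×ₗ Fin n := fun v => toLex (f v, i v)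
  have hg : Function.Injective g := fun u v h =>
    i.injective (congrArg (fun x => (ofLex x).2) h)
  refine ⟨⟨G.ascents g, ?_, G.isAcyclic_ascents g⟩, fun e he => Prod.Lex.left _ _ he⟩
  simpa only [hg.ne_iff] using G.isOrientation_ascents g

/-- Every acyclic orientation consists of the ascending edges of a function. -/
theorem AcyclicOrientation.exists_eq_ascents {G : CutGraph V E} [Finite V]
    (D : G.AcyclicOrientation) : ∃ f : V → ℝ, D.1 = G.ascents f := by
  -- The potential counts strict predecessors. Along an edge of `D` the tail is a new predecessor,
  -- since acyclicity keeps it from preceding itself.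
  let P : V → Set V := fun v => {u | Relation.TransGen (G.Step D.1) u v}
  have key : ∀ e ∈ D.1, e ∈ G.ascents fun v => ((P v).ncard : ℝ) := by
    intro e he
    have hs : G.Step D.1 (G.tail e) (G.head e) := ⟨e, he, rfl, rfl⟩
    rw [mem_ascents, Nat.cast_lt]
    refine Set.ncard_lt_ncard ⟨fun u hu => hu.tail hs, fun hc => ?_⟩ (Set.toFinite _)
    exact D.2.2 _ (hc (Relation.TransGen.single hs))
  refine ⟨fun v => ((P v).ncard : ℝ), Set.Subset.antisymm key fun e he => ?_⟩
  have hne : G.tail e ≠ G.head e := fun hc => (mem_ascents.1 he).ne (by simp only [hc])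
  by_contra hc
  have := key _ ((D.bar_mem_iff hne).2 hc)
  rw [mem_ascents, G.tail_bar, G.head_bar] at this
  exact lt_asymm he this

/-- The coherent acyclic orientations of cut subgraphs are the sets of ascending edges. -/
theorem exists_isCoherentAcyclic_iff (G : CutGraph V E) [Fintype V] {D : Set E} :
    (∃ H, G.IsCoherentAcyclic H D) ↔ ∃ f : V → ℝ, D = G.ascents f := by
  constructor
  · rintro ⟨H, ⟨hDH, -⟩, s, p, -, rfl, h⟩
    refine ⟨fun v => ((p v : ℕ) : ℝ), Set.ext fun e => ?_⟩
    rw [mem_ascents, Nat.cast_lt, Fin.val_fin_lt]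
    exact ⟨fun he => (h e (hDH he)).1 he, fun he => (h e (ne_of_lt he)).2 he⟩
  · rintro ⟨f, rfl⟩
    classical
    -- The parts are the level sets of `f`, indexed by the rank of their value.
    let s := Finset.univ.image f
    let o := s.orderIsoOfFin rfl
    let p : V → Fin s.card := fun v =>
      o.symm ⟨f v, Finset.mem_image_of_mem f (Finset.mem_univ v)⟩
    have hlt : ∀ u v, p u < p v ↔ f u < f v := fun u v => o.symm.lt_iff_lt
    have hasc : G.ascents f = G.ascents p := Set.ext fun e => (hlt _ _).symm
    refine ⟨G.cutSubgraph p, hasc ▸ G.isOrientation_ascents p, s.card, p, ?_, rfl,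
      fun e _ => (hlt _ _).symm⟩
    intro i
    obtain ⟨v, -, hv⟩ := Finset.mem_image.1 (o i).2
    refine ⟨v, ?_⟩
    rw [OrderIso.symm_apply_eq]
    exact Subtype.ext hv

/-- A small perturbation of `f` keeps its ascending edges. -/
theorem exists_ascents_subset_ascents_add_smul (G : CutGraph V E) [Finite E] (f g : V → ℝ) :
    ∃ ε > (0 : ℝ), G.ascents f ⊆ G.ascents (f + ε • g) := by
  -- Each ascent is a strict inequality, hence open in `ε`, and there are finitely many.
  have h : ∀ e ∈ G.ascents f, ∀ᶠ ε : ℝ in nhdsWithin 0 (Set.Ioi 0), e ∈ G.ascents (f + ε • g) := by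
    intro e he
    have hc : Filter.Tendsto (fun ε : ℝ => (f (G.head e) + ε * g (G.head e)) -
        (f (G.tail e) + ε * g (G.tail e))) (nhdsWithin 0 (Set.Ioi 0))
        (nhds ((f (G.head e) + 0 * g (G.head e)) - (f (G.tail e) + 0 * g (G.tail e)))) :=
      (Continuous.tendsto (by fun_prop) 0).mono_left nhdsWithin_le_nhds
    have hpos : 0 < (f (G.head e) + 0 * g (G.head e)) - (f (G.tail e) + 0 * g (G.tail e)) := by
      simpa using mem_ascents.1 he
    filter_upwards [hc.eventually (lt_mem_nhds hpos)] with ε hε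
    simpa [mem_ascents] using hε
  obtain ⟨ε, hε, hpos⟩ := (((Set.toFinite (G.ascents f)).eventually_all.2 h).and
    (self_mem_nhdsWithin)).exists
  exact ⟨ε, hpos, fun e he => hε e he⟩

/-! ### The inner product and the cut norm -/

theorem d_apply (G : CutGraph V E) (f : V → ℝ) (e : E) :
    (G.d ℝ f).1 e = f (G.head e) - f (G.tail e) := rfl

theorem mem_ascents_iff_d {G : CutGraph V E} {f : V → ℝ} {e : E} :
    e ∈ G.ascents f ↔ 0 < (G.d ℝ f).1 e := by
  rw [d_apply, sub_pos, mem_ascents]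

theorem d_eq_zero_of_ascents_eq_empty {G : CutGraph V E} {f : V → ℝ} (h : G.ascents f = ∅) :
    G.d ℝ f = 0 := by
  refine Subtype.ext (funext fun e => le_antisymm ?_ ?_)
  · exact not_lt.1 fun hc => (h ▸ mem_ascents_iff_d.2 hc : e ∈ (∅ : Set E))
  · have h1 : ¬ 0 < (G.d ℝ f).1 (G.bar e) := fun hc =>
      (h ▸ mem_ascents_iff_d.2 hc : G.bar e ∈ (∅ : Set E))
    rw [(G.d ℝ f).2 e] at h1
    simpa using h1

theorem cutElement_mem_cutLattice (G : CutGraph V E) (C : Set V) :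
    G.cutElement C ∈ G.cutLattice := by
  classical
  refine ⟨C.indicator (1 : V → ℤ), ?_⟩
  change G.d ℝ (fun v => ((C.indicator (1 : V → ℤ) v : ℤ) : ℝ)) = _
  rw [cutElement]
  congr 1
  ext v
  by_cases hv : v ∈ C <;> simp [hv]

theorem ascents_indicator (G : CutGraph V E) (C : Set V) :
    G.ascents (C.indicator (1 : V → ℝ)) = {e | G.head e ∈ C ∧ G.tail e ∉ C} := by
  classical
  ext e
  rw [mem_ascents]
  by_cases h1 : G.head e ∈ C <;> by_cases h2 : G.tail e ∈ C <;> simp [h1, h2]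

theorem supp_cutElement (G : CutGraph V E) (C : Set V) :
    G.supp (G.cutElement C) = G.ascents (C.indicator (1 : V → ℝ)) :=
  Set.ext fun _ => mem_ascents_iff_d.symm

/-- The cochain with value `1/2` on the edges of an orientation. -/
noncomputable def halfCochain (G : CutGraph V E) (D : Set E) : G.cochains ℝ :=
  ⟨fun e => (D.indicator 1 e - D.indicator 1 (G.bar e)) / 2, fun e => by
    simp only [G.bar_bar]
    ring⟩

theorem AcyclicOrientation.halfCochain_of_mem {G : CutGraph V E} (D : G.AcyclicOrientation)
    {e : E} (he : e ∈ D.1) : (G.halfCochain D.1).1 e = 1 / 2 := by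
  have := mt (D.bar_mem_iff (D.not_loop he)).1 (not_not.2 he)
  simp [halfCochain, he, this]

theorem AcyclicOrientation.halfCochain_of_notMem {G : CutGraph V E} (D : G.AcyclicOrientation)
    {e : E} (hne : G.tail e ≠ G.head e) (he : e ∉ D.1) :
    (G.halfCochain D.1).1 e = -(1 / 2) := by
  have := (D.bar_mem_iff hne).2 he
  simp [halfCochain, he, this, neg_div]

theorem AcyclicOrientation.halfCochain_mul_le {G : CutGraph V E} (D : G.AcyclicOrientation)
    (f : V → ℝ) (e : E) :
    (G.halfCochain D.1).1 e * (G.d ℝ f).1 e ≤ |(G.d ℝ f).1 e| / 2 := by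
  by_cases hne : G.tail e = G.head e
  · simp [d_apply, hne]
  by_cases he : e ∈ D.1
  · rw [D.halfCochain_of_mem he]
    linarith [le_abs_self ((G.d ℝ f).1 e)]
  · rw [D.halfCochain_of_notMem hne he]
    linarith [neg_abs_le ((G.d ℝ f).1 e)]

section Metric

variable [Fintype E]

/-- The inner product as a bilinear map. -/
noncomputable def ipBilin (G : CutGraph V E) : G.cochains ℝ →ₗ[ℝ] G.cochains ℝ →ₗ[ℝ] ℝ :=
  LinearMap.mk₂ ℝ G.ip
    (fun x y z => by simp [ip, add_mul, Finset.sum_add_distrib, mul_add])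
    (fun c x y => by simp [ip, mul_assoc, Finset.mul_sum, mul_left_comm])
    (fun x y z => by simp [ip, mul_add, Finset.sum_add_distrib])
    (fun c x y => by simp [ip, Finset.mul_sum, mul_left_comm])

theorem ip_comm (G : CutGraph V E) (x y : G.cochains ℝ) : G.ip x y = G.ip y x := by
  simp [ip, mul_comm]

theorem ip_sub_right (G : CutGraph V E) (x y z : G.cochains ℝ) :
    G.ip x (y - z) = G.ip x y - G.ip x z := (G.ipBilin x).map_sub y z

theorem ip_add_right (G : CutGraph V E) (x y z : G.cochains ℝ) :
    G.ip x (y + z) = G.ip x y + G.ip x z := (G.ipBilin x).map_add y z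

theorem ip_smul_right (G : CutGraph V E) (x y : G.cochains ℝ) (c : ℝ) :
    G.ip x (c • y) = c * G.ip x y := (G.ipBilin x).map_smul c y

theorem eq_zero_of_ip_self (G : CutGraph V E) {x : G.cochains ℝ} (h : G.ip x x = 0) : x = 0 := by
  rw [ip, mul_eq_zero, Finset.sum_eq_zero_iff_of_nonneg fun e _ => mul_self_nonneg _] at h
  refine Subtype.ext (funext fun e => ?_)
  simpa using (h.resolve_left (by norm_num)) e (Finset.mem_univ e)

theorem q_sub (G : CutGraph V E) (x y : G.cochains ℝ) :
    G.q (x - y) = G.q x - 2 * G.ip x y + G.q y := by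
  have h : G.ip (x - y) (x - y) = G.ip x x - G.ip y x - (G.ip x y - G.ip y y) := by
    rw [ip_sub_right, G.ip_comm _ x, G.ip_comm _ y, ip_sub_right, ip_sub_right, G.ip_comm x y]
  rw [q, h, G.ip_comm y x, q, q]
  ring

/-- An anisotropic bilinear form on a finite-dimensional space represents every linear form. -/
theorem exists_eq_of_anisotropic {W : Type*} [AddCommGroup W] [Module ℝ W]
    [FiniteDimensional ℝ W] (B : W →ₗ[ℝ] W →ₗ[ℝ] ℝ) (hB : ∀ x, B x x = 0 → x = 0)
    (l : W →ₗ[ℝ] ℝ) : ∃ y, B y = l := by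
  have hinj : Function.Injective B :=
    LinearMap.ker_eq_bot.1 (LinearMap.ker_eq_bot'.2 fun x hx => hB x (by rw [hx]; rfl))
  exact (LinearMap.injective_iff_surjective_of_finrank_eq_finrank (f := B)
    Subspace.dual_finrank_eq.symm).1 hinj l

/-- Every linear form is represented on the cut space by a cut. -/
theorem exists_cut_representing (G : CutGraph V E) (l : G.cochains ℝ →ₗ[ℝ] ℝ) :
    ∃ y ∈ G.cutSpace, ∀ x ∈ G.cutSpace, l x = G.ip y x := by
  obtain ⟨y, hy⟩ := exists_eq_of_anisotropic (W := G.cutSpace)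
    (G.ipBilin.domRestrict₁₂ G.cutSpace G.cutSpace)
    (fun x hx => Subtype.ext (G.eq_zero_of_ip_self hx)) (l.domRestrict G.cutSpace)
  exact ⟨y, y.2, fun x hx => (LinearMap.congr_fun hy ⟨x, hx⟩).symm⟩

/-- Half the total variation of `f` over the unoriented edges. -/
noncomputable def cutNorm (G : CutGraph V E) (f : V → ℝ) : ℝ :=
  (1 / 2) * ∑ e, |(G.d ℝ f).1 e| / 2

theorem mem_voronoiCell_iff {G : CutGraph V E} {x : G.cochains ℝ} :
    x ∈ G.voronoiCell 0 ↔ x ∈ G.cutSpace ∧ ∀ mu ∈ G.cutLattice, 2 * G.ip x mu ≤ G.q mu := by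
  refine and_congr_right fun _ => forall₂_congr fun mu _ => ?_
  rw [sub_zero, q_sub]
  constructor <;> intro h <;> linarith

/-- The values of the cochain are `0` and `±1`, where squares equal absolute values. -/
theorem q_cutElement (G : CutGraph V E) (C : Set V) :
    G.q (G.cutElement C) = 2 * G.cutNorm (C.indicator 1) := by
  classical
  rw [q, ip, cutNorm, mul_left_comm, Finset.mul_sum _ _ (2 : ℝ)]
  congr 1
  refine Finset.sum_congr rfl fun e _ => ?_
  rw [cutElement, d_apply]
  by_cases h1 : G.head e ∈ C <;> by_cases h2 : G.tail e ∈ C <;> simp [h1, h2]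

/-- If `g` ascends only along ascending edges of `f`, a multiple of `g` can be split off from `f`
without cancellation and so that an ascending edge disappears. -/
theorem exists_split_ascents (G : CutGraph V E) {f g : V → ℝ} (h : G.ascents g ⊆ G.ascents f)
    (hne : (G.ascents g).Nonempty) :
    ∃ ε > (0 : ℝ), G.ascents (f - ε • g) ⊂ G.ascents f ∧
      G.cutNorm f = G.cutNorm (f - ε • g) + ε * G.cutNorm g := by
  -- The smallest ratio `d f / d g` over the ascents of `g` is the largest multiple of `g` removable
  -- without reversing a sign; at the minimizer `a` the difference vanishes.
  obtain ⟨a, ha, hmin⟩ := (Set.toFinite (G.ascents g)).exists_minimalFor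
    (fun e => (G.d ℝ f).1 e / (G.d ℝ g).1 e) _ hne
  have hga : 0 < (G.d ℝ g).1 a := mem_ascents_iff_d.1 ha
  have hfa : 0 < (G.d ℝ f).1 a := mem_ascents_iff_d.1 (h ha)
  set ε := (G.d ℝ f).1 a / (G.d ℝ g).1 a with hε
  have hεpos : 0 < ε := div_pos hfa hga
  have hle : ∀ e, 0 < (G.d ℝ g).1 e → ε * (G.d ℝ g).1 e ≤ (G.d ℝ f).1 e := by
    intro e he
    rw [← le_div_iff₀ he]
    rcases le_total ε ((G.d ℝ f).1 e / (G.d ℝ g).1 e) with h1 | h1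
    · exact h1
    · exact hmin (mem_ascents_iff_d.2 he) h1
  have hge : ∀ e, (G.d ℝ g).1 e < 0 → (G.d ℝ f).1 e ≤ ε * (G.d ℝ g).1 e := by
    intro e he
    have := hle (G.bar e)
    rw [(G.d ℝ g).2 e, (G.d ℝ f).2 e] at this
    linarith [this (by linarith)]
  have hd : ∀ e, (G.d ℝ (f - ε • g)).1 e = (G.d ℝ f).1 e - ε * (G.d ℝ g).1 e := by
    intro e
    simp only [d_apply, Pi.sub_apply, Pi.smul_apply, smul_eq_mul]
    ring
  refine ⟨ε, hεpos, ⟨fun e he => ?_, fun hc => ?_⟩, ?_⟩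
  · rw [mem_ascents_iff_d, hd] at he
    rcases lt_trichotomy ((G.d ℝ g).1 e) 0 with h1 | h1 | h1
    · linarith [hge e h1]
    · rw [h1] at he
      exact mem_ascents_iff_d.2 (by simpa using he)
    · exact h (mem_ascents_iff_d.2 h1)
  · have := hc (h ha)
    rw [mem_ascents_iff_d, hd, hε, div_mul_cancel₀ _ hga.ne', sub_self] at this
    exact lt_irrefl _ this
  · rw [cutNorm, cutNorm, cutNorm, mul_left_comm, ← mul_add, Finset.mul_sum _ _ ε,
      ← Finset.sum_add_distrib]
    congr 1
    refine Finset.sum_congr rfl fun e _ => ?_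
    rw [hd]
    rcases lt_trichotomy ((G.d ℝ g).1 e) 0 with h1 | h1 | h1
    · have h2 := hge e h1
      have h3 := mul_neg_of_pos_of_neg hεpos h1
      rw [abs_of_neg h1, abs_of_neg (h2.trans_lt h3), abs_of_nonpos (sub_nonpos.2 h2)]
      ring
    · simp [h1]
    · have h2 := hle e h1
      have h3 := mul_pos hεpos h1
      rw [abs_of_pos h1, abs_of_pos (h3.trans_le h2), abs_of_nonneg (sub_nonneg.2 h2)]
      ring

theorem ip_d_sub_smul (G : CutGraph V E) (x : G.cochains ℝ) (f g : V → ℝ) (ε : ℝ) :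
    G.ip x (G.d ℝ (f - ε • g)) = G.ip x (G.d ℝ f) - ε * G.ip x (G.d ℝ g) := by
  rw [map_sub, map_smul, ip_sub_right, ip_smul_right]

/-- Induction on the number of ascending edges: splitting off the indicator of a superlevel set
removes at least one, and the Voronoi inequality for that indicator bounds the part removed. -/
theorem ip_le_cutNorm (G : CutGraph V E) {x : G.cochains ℝ} (hx : x ∈ G.voronoiCell 0)
    (f : V → ℝ) : G.ip x (G.d ℝ f) ≤ G.cutNorm f := by
  induction hn : (G.ascents f).ncard using Nat.strong_induction_on generalizing f with
  | _ n ih =>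
    rcases (G.ascents f).eq_empty_or_nonempty with h0 | ⟨a, ha⟩
    · rw [cutNorm, d_eq_zero_of_ascents_eq_empty h0]
      simp [ip]
    · let C : Set V := {v | f (G.head a) ≤ f v}
      have hsub : G.ascents (C.indicator (1 : V → ℝ)) ⊆ G.ascents f := by
        rw [ascents_indicator]
        intro e he
        have h1 : f (G.head a) ≤ f (G.head e) := he.1
        exact (not_le.1 he.2).trans_le h1
      have hne : (G.ascents (C.indicator (1 : V → ℝ))).Nonempty := by
        rw [ascents_indicator]
        exact ⟨a, le_refl (f (G.head a)), not_le_of_gt (mem_ascents.1 ha)⟩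
      obtain ⟨ε, hε, hlt, hN⟩ := G.exists_split_ascents hsub hne
      have h1 := ih _ (hn ▸ Set.ncard_lt_ncard hlt (Set.toFinite _)) _ rfl
      have h2 := (mem_voronoiCell_iff.1 hx).2 _ (G.cutElement_mem_cutLattice C)
      rw [q_cutElement, cutElement] at h2
      rw [ip_d_sub_smul] at h1
      have h3 := mul_le_mul_of_nonneg_left h2 hε.le
      rw [hN]
      linarith

/-- The face of the Voronoi cell on which pairing with `d f` attains its maximum. -/
def cutFace (G : CutGraph V E) (f : V → ℝ) : Set (G.cochains ℝ) :=
  {x | x ∈ G.voronoiCell 0 ∧ G.ip x (G.d ℝ f) = G.cutNorm f}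

/-- Since `cutNorm f` splits as a sum and each summand bounds its own pairing, equality for `f`
forces equality for `g`. -/
theorem cutFace_subset_of_ascents_subset (G : CutGraph V E) {f g : V → ℝ}
    (h : G.ascents g ⊆ G.ascents f) : G.cutFace f ⊆ G.cutFace g := by
  rintro x ⟨hx, hxf⟩
  refine ⟨hx, ?_⟩
  rcases (G.ascents g).eq_empty_or_nonempty with h0 | hne
  · rw [cutNorm, d_eq_zero_of_ascents_eq_empty h0]
    simp [ip]
  · obtain ⟨ε, hε, -, hN⟩ := G.exists_split_ascents h hne
    have h1 := G.ip_le_cutNorm hx (f - ε • g)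
    rw [ip_d_sub_smul] at h1
    refine le_antisymm (G.ip_le_cutNorm hx g) (le_of_mul_le_mul_left ?_ hε)
    linarith

theorem convex_cutFace (G : CutGraph V E) (f : V → ℝ) : Convex ℝ (G.cutFace f) := by
  rintro x ⟨hx, hxf⟩ y ⟨hy, hyf⟩ a b ha hb hab
  rw [mem_voronoiCell_iff] at hx hy
  have hip : ∀ z, G.ip (a • x + b • y) z = a * G.ip x z + b * G.ip y z := fun z => by
    rw [G.ip_comm, ip_add_right, ip_smul_right, ip_smul_right, G.ip_comm z, G.ip_comm z]
  refine ⟨mem_voronoiCell_iff.2 ⟨?_, fun mu hmu => ?_⟩, ?_⟩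
  · exact add_mem (Submodule.smul_mem _ _ hx.1) (Submodule.smul_mem _ _ hy.1)
  · have h1 := mul_le_mul_of_nonneg_left (hx.2 mu hmu) ha
    have h2 := mul_le_mul_of_nonneg_left (hy.2 mu hmu) hb
    have h3 : G.q mu = a * G.q mu + b * G.q mu := by rw [← add_mul, hab, one_mul]
    rw [hip]
    linarith
  · rw [hip, hxf, hyf, ← add_mul, hab, one_mul]

/-! ### The vertices of the Voronoi cell -/

/-- The orthogonal projection of `halfCochain D` to the cut space. -/
noncomputable def orientationPoint (G : CutGraph V E) (D : Set E) : G.cochains ℝ :=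
  (G.exists_cut_representing (G.ipBilin (G.halfCochain D))).choose

theorem orientationPoint_mem_cutSpace (G : CutGraph V E) (D : Set E) :
    G.orientationPoint D ∈ G.cutSpace :=
  (G.exists_cut_representing (G.ipBilin (G.halfCochain D))).choose_spec.1

theorem ip_orientationPoint (G : CutGraph V E) (D : Set E) (f : V → ℝ) :
    G.ip (G.orientationPoint D) (G.d ℝ f) = G.ip (G.halfCochain D) (G.d ℝ f) :=
  ((G.exists_cut_representing (G.ipBilin (G.halfCochain D))).choose_spec.2 _ ⟨f, rfl⟩).symm

theorem AcyclicOrientation.ip_le_cutNorm {G : CutGraph V E} (D : G.AcyclicOrientation)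
    (f : V → ℝ) : G.ip (G.orientationPoint D.1) (G.d ℝ f) ≤ G.cutNorm f := by
  rw [ip_orientationPoint, ip, cutNorm]
  exact mul_le_mul_of_nonneg_left (Finset.sum_le_sum fun e _ => D.halfCochain_mul_le f e)
    (by norm_num)

/-- The bound holds edge by edge, so equality means that the signs of the half-cochain and of `d f`
agree wherever `d f` is nonzero. -/
theorem AcyclicOrientation.ip_eq_cutNorm_iff {G : CutGraph V E} (D : G.AcyclicOrientation)
    {f : V → ℝ} :
    G.ip (G.orientationPoint D.1) (G.d ℝ f) = G.cutNorm f ↔ G.ascents f ⊆ D.1 := by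
  rw [ip_orientationPoint, ip, cutNorm, mul_right_inj' (by norm_num),
    Finset.sum_eq_sum_iff_of_le fun e _ => D.halfCochain_mul_le f e]
  constructor
  · intro h e he
    by_contra hc
    have hne : G.tail e ≠ G.head e := fun hc => (mem_ascents.1 he).ne (congrArg f hc)
    have h1 := h e (Finset.mem_univ e)
    have h2 := mem_ascents_iff_d.1 he
    rw [D.halfCochain_of_notMem hne hc, abs_of_pos h2] at h1
    linarith
  · intro h e _
    rcases lt_trichotomy ((G.d ℝ f).1 e) 0 with h1 | h1 | h1
    · have h2 : G.bar e ∈ D.1 := h (mem_ascents_iff_d.2 (by rw [(G.d ℝ f).2 e]; linarith))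
      have h3 := D.halfCochain_of_mem h2
      rw [(G.halfCochain D.1).2 e] at h3
      rw [abs_of_neg h1, neg_eq_iff_eq_neg.1 h3]
      ring
    · simp [h1]
    · rw [D.halfCochain_of_mem (h (mem_ascents_iff_d.2 h1)), abs_of_pos h1]
      ring

/-- Integrality enters through `|n| ≤ n ^ 2`, which gives `2 * cutNorm f ≤ q (d f)` for
integer-valued `f`. -/
theorem AcyclicOrientation.point_mem_voronoiCell {G : CutGraph V E} (D : G.AcyclicOrientation) :
    G.orientationPoint D.1 ∈ G.voronoiCell 0 := by
  refine mem_voronoiCell_iff.2 ⟨G.orientationPoint_mem_cutSpace _, ?_⟩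
  rintro _ ⟨f, rfl⟩
  have h := D.ip_le_cutNorm fun v => (f v : ℝ)
  change 2 * G.ip _ (G.d ℝ fun v => (f v : ℝ)) ≤ G.q (G.d ℝ fun v => (f v : ℝ))
  refine (mul_le_mul_of_nonneg_left h zero_le_two).trans ?_
  rw [q, ip, cutNorm, mul_left_comm, Finset.mul_sum]
  refine mul_le_mul_of_nonneg_left (Finset.sum_le_sum fun e _ => ?_) (by norm_num)
  rw [mul_div_cancel₀ _ two_ne_zero, ← abs_mul_abs_self ((G.d ℝ _).1 e), d_apply]
  have : |f (G.head e) - f (G.tail e)| ≤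
      |f (G.head e) - f (G.tail e)| * |f (G.head e) - f (G.tail e)| := by
    rw [← sq]
    exact Int.le_self_sq _
  exact_mod_cast this

theorem AcyclicOrientation.point_mem_cutFace_iff {G : CutGraph V E} (D : G.AcyclicOrientation)
    {f : V → ℝ} : G.orientationPoint D.1 ∈ G.cutFace f ↔ G.ascents f ⊆ D.1 :=
  (and_iff_right D.point_mem_voronoiCell).trans D.ip_eq_cutNorm_iff

theorem cutFace_nonempty (G : CutGraph V E) [Finite V] (f : V → ℝ) : (G.cutFace f).Nonempty := by
  obtain ⟨D, hD⟩ := G.exists_acyclicOrientation_ascents_subset f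
  exact ⟨_, D.point_mem_cutFace_iff.2 hD⟩

theorem cutFace_eq_maximizers (G : CutGraph V E) [Finite V] {f : V → ℝ}
    {l : G.cochains ℝ →L[ℝ] ℝ} (hl : ∀ x ∈ G.cutSpace, l x = G.ip x (G.d ℝ f)) :
    G.cutFace f = {x ∈ G.voronoiCell 0 | ∀ y ∈ G.voronoiCell 0, l y ≤ l x} := by
  ext x
  refine and_congr_right fun hx => ⟨fun h y hy => ?_, fun h => ?_⟩
  · rw [hl x hx.1, hl y hy.1, h]
    exact G.ip_le_cutNorm hy f
  · obtain ⟨y, hy, hyf⟩ := G.cutFace_nonempty f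
    have := h y hy
    rw [hl x hx.1, hl y hy.1, hyf] at this
    exact le_antisymm (G.ip_le_cutNorm hx f) this

theorem isExposed_cutFace (G : CutGraph V E) [Finite V] (f : V → ℝ) :
    IsExposed ℝ (G.voronoiCell 0) (G.cutFace f) := fun _ =>
  ⟨LinearMap.toContinuousLinearMap (G.ipBilin (G.d ℝ f)),
    G.cutFace_eq_maximizers fun x _ => G.ip_comm _ x⟩

/-- Every nonempty face of the Voronoi cell maximizes the pairing with a cut. -/
theorem Face.exists_eq_cutFace {G : CutGraph V E} [Finite V] (F : G.Face) :
    ∃ f : V → ℝ, F.1 = G.cutFace f := by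
  obtain ⟨l, hl⟩ := F.2.2 F.2.1
  obtain ⟨_, ⟨f, rfl⟩, hf⟩ := G.exists_cut_representing l.toLinearMap
  exact ⟨f, hl.trans (G.cutFace_eq_maximizers fun x hx => (hf x hx).trans (G.ip_comm _ _)).symm⟩

theorem cutFace_eq_convexHull (G : CutGraph V E) [Finite V] (f : V → ℝ) :
    G.cutFace f = convexHull ℝ
      {x | ∃ D : G.AcyclicOrientation, G.ascents f ⊆ D.1 ∧ x = G.orientationPoint D.1} := by
  set S := {x | ∃ D : G.AcyclicOrientation, G.ascents f ⊆ D.1 ∧ x = G.orientationPoint D.1}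
  refine Set.Subset.antisymm (fun x hx => ?_) (convexHull_min ?_ (G.convex_cutFace f))
  · by_contra hxS
    have hfin : S.Finite := (Set.finite_range fun D : G.AcyclicOrientation =>
      G.orientationPoint D.1).subset (by rintro _ ⟨D, -, rfl⟩; exact ⟨D, rfl⟩)
    obtain ⟨l, u, hlu, hux⟩ := geometric_hahn_banach_closed_point (convex_convexHull ℝ S)
      (hfin.isClosed_convexHull ℝ) hxS
    obtain ⟨_, ⟨g, rfl⟩, hg⟩ := G.exists_cut_representing l.toLinearMap
    -- If `g` separates `x` from the hull, an orientation containing the ascents of `f + ε • g` also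
    -- contains those of `f`. Its point lies in `S` and maximizes the perturbed pairing over the
    -- cell, so `g` cannot be larger at `x`.
    obtain ⟨ε, hε, hsub⟩ := G.exists_ascents_subset_ascents_add_smul f g
    obtain ⟨D, hD⟩ := G.exists_acyclicOrientation_ascents_subset (f + ε • g)
    have h1 := hlu _ (subset_convexHull ℝ S ⟨D, hsub.trans hD, rfl⟩)
    have h2 := D.ip_eq_cutNorm_iff.2 hD
    have h3 := D.ip_eq_cutNorm_iff.2 (hsub.trans hD)
    have h4 := G.ip_le_cutNorm hx.1 (f + ε • g)
    have h5 : l x = G.ip (G.d ℝ g) x := hg x hx.1.1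
    have h6 : l (G.orientationPoint D.1) = G.ip (G.d ℝ g) (G.orientationPoint D.1) :=
      hg _ (G.orientationPoint_mem_cutSpace _)
    rw [← h2, map_add, map_smul, ip_add_right, ip_add_right, ip_smul_right, ip_smul_right,
      hx.2, h3, G.ip_comm x, G.ip_comm _ (G.d ℝ g), ← h5, ← h6] at h4
    have h7 := mul_lt_mul_of_pos_left (h1.trans hux) hε
    linarith
  · rintro _ ⟨D, hD, rfl⟩
    exact D.point_mem_cutFace_iff.2 hD

/-! ### The oriented subgraph attached to a face -/

/-- As `q` is twice the cut norm here, the bisector equation is the equality case of the support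
bound. -/
theorem mem_bisector_cutElement_iff {G : CutGraph V E} {C : Set V} {x : G.cochains ℝ}
    (hx : x ∈ G.voronoiCell 0) :
    x ∈ G.bisector (G.cutElement C) ↔ x ∈ G.cutFace (C.indicator 1) := by
  refine (and_iff_right hx.1).trans (Iff.trans ?_ (and_iff_right hx).symm)
  rw [q_cutElement, mul_right_inj' two_ne_zero, cutElement]

theorem faceEdges_cutFace (G : CutGraph V E) [Finite V] (hG : G.Connected) (f : V → ℝ) :
    G.faceEdges (G.cutFace f) = G.ascents f := by
  classical
  ext e
  constructor
  · rintro ⟨_, ⟨C, -, rfl⟩, hF, he⟩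
    by_contra hc
    rw [mem_ascents, not_lt] at hc
    rw [supp_cutElement] at he
    have hne : G.tail e ≠ G.head e := fun hc => (mem_ascents.1 he).ne (congrArg _ hc)
    -- If `e` does not ascend, raising `f` slightly at its tail makes `bar e` ascend and keeps all
    -- ascents of `f`. The resulting orientation gives a point of the face off the bisector.
    obtain ⟨ε, hε, hsub⟩ := G.exists_ascents_subset_ascents_add_smul f (Pi.single (G.tail e) 1)
    obtain ⟨D, hD⟩ :=
      G.exists_acyclicOrientation_ascents_subset (f + ε • Pi.single (G.tail e) (1 : ℝ))
    have hbar : G.bar e ∈ D.1 := by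
      apply hD
      rw [mem_ascents, G.tail_bar, G.head_bar]
      simp only [Pi.add_apply, Pi.smul_apply, smul_eq_mul, Pi.single_eq_same,
        Pi.single_eq_of_ne hne.symm]
      linarith
    have h1 := hF (D.point_mem_cutFace_iff.2 (hsub.trans hD))
    rw [mem_bisector_cutElement_iff D.point_mem_voronoiCell, D.point_mem_cutFace_iff] at h1
    exact (D.bar_mem_iff hne).1 hbar (h1 he)
  · intro he
    -- The superlevel set at the head of `e` is cut only by ascents of `f`, and so is a bond inside
    -- that cut.
    obtain ⟨B, hB, hhB, htB, hBC⟩ := G.exists_bond_of_cut hG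
      (C := {v | f (G.head e) ≤ f v}) (le_refl (f (G.head e))) (not_le_of_gt (mem_ascents.1 he))
    refine ⟨G.cutElement B, ⟨B, hB, rfl⟩, fun x hx => ?_, ?_⟩
    · rw [mem_bisector_cutElement_iff hx.1]
      refine G.cutFace_subset_of_ascents_subset ?_ hx
      rw [ascents_indicator]
      intro a ha
      have := hBC a ha.1 ha.2
      have h1 : f (G.head e) ≤ f (G.head a) := this.1
      exact (not_le.1 this.2).trans_le h1
    · rw [supp_cutElement, ascents_indicator]
      exact ⟨hhB, htB⟩

theorem faceEdges_anti (G : CutGraph V E) {F F' : Set (G.cochains ℝ)} (h : F ⊆ F') :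
    G.faceEdges F' ⊆ G.faceEdges F := by
  rintro e ⟨lam, hlam, hF, he⟩
  exact ⟨lam, hlam, h.trans hF, he⟩

theorem Face.exists_isCoherentAcyclic {G : CutGraph V E} [Fintype V] (hG : G.Connected)
    (F : G.Face) : ∃ H, G.IsCoherentAcyclic H (G.faceEdges F.1) := by
  obtain ⟨f, hf⟩ := F.exists_eq_cutFace
  rw [hf, G.faceEdges_cutFace hG, exists_isCoherentAcyclic_iff]
  exact ⟨f, rfl⟩

/-- The isomorphism between the face poset of the Voronoi cell and the poset of coherent acyclic
orientations of cut subgraphs. -/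
noncomputable def faceOrderIso (G : CutGraph V E) [Fintype V] (hG : G.Connected) :
    G.Face ≃o G.CAC :=
  RelIso.ofSurjective
    (OrderEmbedding.ofMapLEIff (fun F => ⟨G.faceEdges F.1, F.exists_isCoherentAcyclic hG⟩) <| by
      intro F F'
      refine ⟨fun h => ?_, G.faceEdges_anti⟩
      obtain ⟨f, hf⟩ := F.exists_eq_cutFace
      obtain ⟨g, hg⟩ := F'.exists_eq_cutFace
      have h' : G.faceEdges F'.1 ⊆ G.faceEdges F.1 := h
      rw [hf, hg, G.faceEdges_cutFace hG, G.faceEdges_cutFace hG] at h'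
      change F.1 ⊆ F'.1
      rw [hf, hg]
      exact G.cutFace_subset_of_ascents_subset h')
    (by
      rintro ⟨D, hD⟩
      obtain ⟨f, rfl⟩ := G.exists_isCoherentAcyclic_iff.1 hD
      refine ⟨⟨G.cutFace f, G.cutFace_nonempty f, G.isExposed_cutFace f⟩, ?_⟩
      simp only [OrderEmbedding.coe_ofMapLEIff, G.faceEdges_cutFace hG])

theorem faceOrderIso_edges (G : CutGraph V E) [Fintype V] (hG : G.Connected) (F : G.Face) :
    (G.faceOrderIso hG F).edges = G.faceEdges F.1 := rfl

/-- No other acyclic orientation contains `D`, so the convex hull for a potential of `D` has a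
single generator. -/
theorem AcyclicOrientation.exists_singleton_eq_cutFace {G : CutGraph V E} [Finite V]
    (D : G.AcyclicOrientation) :
    ∃ f : V → ℝ, D.1 = G.ascents f ∧ {G.orientationPoint D.1} = G.cutFace f := by
  obtain ⟨f, hf⟩ := D.exists_eq_ascents
  refine ⟨f, hf, ?_⟩
  rw [G.cutFace_eq_convexHull, ← convexHull_singleton (𝕜 := ℝ), ← hf]
  congr 1
  ext x
  constructor
  · rintro rfl
    exact ⟨D, subset_rfl, rfl⟩
  · rintro ⟨D', hD', rfl⟩
    rw [AcyclicOrientation.eq_of_subset hD']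
    rfl

theorem AcyclicOrientation.isExposed_point {G : CutGraph V E} [Finite V]
    (D : G.AcyclicOrientation) : IsExposed ℝ (G.voronoiCell 0) {G.orientationPoint D.1} := by
  obtain ⟨f, -, hf⟩ := D.exists_singleton_eq_cutFace
  exact hf ▸ G.isExposed_cutFace f

theorem AcyclicOrientation.faceEdges_point {G : CutGraph V E} [Finite V] (hG : G.Connected)
    (D : G.AcyclicOrientation) : G.faceEdges {G.orientationPoint D.1} = D.1 := by
  obtain ⟨f, hD, hf⟩ := D.exists_singleton_eq_cutFace
  rw [hf, G.faceEdges_cutFace hG, hD]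

theorem voronoiCell_eq_cutFace_zero (G : CutGraph V E) : G.voronoiCell 0 = G.cutFace 0 := by
  ext x
  refine (and_iff_left ?_).symm
  simp [cutNorm, ip]

/-- The bijection between acyclic orientations and vertices of the Voronoi cell. -/
noncomputable def vertexEquiv (G : CutGraph V E) [Finite V] (hG : G.Connected) :
    G.AcyclicOrientation ≃ (G.voronoiCell 0).extremePoints ℝ :=
  Equiv.ofBijective
    (fun D => ⟨G.orientationPoint D.1, isExtreme_singleton.1 D.isExposed_point.isExtreme⟩) <| by
    constructor
    · intro D D' h
      have h' : G.orientationPoint D.1 = G.orientationPoint D'.1 := congrArg Subtype.val h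
      rw [← Subtype.coe_inj, ← D.faceEdges_point hG, h', D'.faceEdges_point hG]
    · rintro ⟨x, hx⟩
      -- The zero function has no ascents, so the cell is the hull of all orientation points, and
      -- extreme points of a hull are among its generators.
      rw [voronoiCell_eq_cutFace_zero, cutFace_eq_convexHull] at hx
      obtain ⟨D, -, rfl⟩ := extremePoints_convexHull_subset hx
      exact ⟨D, rfl⟩

theorem vertexEquiv_coe (G : CutGraph V E) [Finite V] (hG : G.Connected)
    (D : G.AcyclicOrientation) : (G.vertexEquiv hG D).1 = G.orientationPoint D.1 := rfl

end Metric

end CutGraph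


theorem mainTheorem3 {V E : Type*} [Fintype V] [Fintype E] (G : CutGraph V E)
    (hG : G.Connected) :
    ∃ Φ : G.Face ≃o G.CAC,
      (∀ F : G.Face, (Φ F).edges = G.faceEdges F.1) ∧
      ∃ ν : G.AcyclicOrientation ≃ (G.voronoiCell 0).extremePoints ℝ,
        (∀ D : G.AcyclicOrientation, ∃ hD : ({(ν D).1} : Set (G.cochains ℝ)).Nonempty ∧
            IsExposed ℝ (G.voronoiCell 0) {(ν D).1},
          (Φ ⟨{(ν D).1}, hD⟩).edges = D.1) ∧
        ∀ F : G.Face,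
          F.1 = convexHull ℝ {x | ∃ D : G.AcyclicOrientation, (Φ F).edges ⊆ D.1 ∧ x = (ν D).1} := by
  refine ⟨G.faceOrderIso hG, G.faceOrderIso_edges hG, G.vertexEquiv hG, fun D => ?_, fun F => ?_⟩
  · exact ⟨⟨Set.singleton_nonempty _, D.isExposed_point⟩, D.faceEdges_point hG⟩
  · obtain ⟨f, hf⟩ := F.exists_eq_cutFace
    simp only [G.faceOrderIso_edges hG, G.vertexEquiv_coe hG, hf, G.faceEdges_cutFace hG]
    exact G.cutFace_eq_convexHull f
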